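/- A delta-matroid $D=(E,\mathcal F)$ consists of a finite set $E=E(D)$ and a non-empty collection $\mathcal F$ of subsets of $E$ (the feasible sets) such that for all $F_1,F_2\in\mathcal F$ and $x\in F_1\bigtriangleup F_2$ there is $y\in F_1\bigtriangleup F_2$ (possibly $y=x$) with $F_1\bigtriangleup\{x,y\}\in\mathcal F$. It is even if the sizes of its feasible sets all have the same parity. The direct sum of delta-matroids $(E_1,\mathcal F_1)$, $(E_2,\mathcal F_2)$ with $E_1\cap E_2=\emptyset$ is $(E_1\cup E_2,\{F_1\cup F_2: F_1\in\mathcal F_1, F_2\in\mathcal F_2\})$. $D$ is connected if it is not the direct sum of two delta-matroids with non-empty ground sets; connectedness of matroids is defined in the same way. For $e\in E$ let $$D\backslash e=(E-e,\{F\in\mathcal F: e\notin F\})\quad\text{if some } F\in\mathcal F \text{ avoids } e,$$ $$D/e=(E-e,\{F-e: e\in F\in\mathcal F\})\quad\text{if some } F\in\mathcal F \text{ contains } e;$$ if $e$ lies in every feasible set, put $D\backslash e=D/e$, and if $e$ lies in no feasible set, put $D/e=D\backslash e$. A minor of $D$ is a delta-matroid obtained from $D$ by a (possibly empty) sequence of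 such deletions and contractions. **Corollary 3.3.** Let $D$ be a connected even delta-matroid with a connected minor $D'$. If $e\in E(D)-E(D')$, then at least one of $D\backslash e$ and $D/e$ is connected and has $D'$ as a minor. In particular (the splitter theorem of Brylawski and Seymour), let $M$ be a connected (finite) matroid with a connected minor $N$. If $e\in E(M)-E(N)$, then at least one of $M\backslash e$ and $M/e$ is connected and has $N$ as a minor. -/

import Mathlib

open Set
open scoped symmDiff Matroid

/-- A delta-matroid `D = (E, 𝓕)` whose elements are taken from the type `α`: a finite ground set `E`
with a non-empty collection of feasible subsets of `E` satisfying the symmetric exchange axiom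
(in which `y = x` is allowed). -/
@[ext]
structure DeltaMatroid (α : Type*) where
  /-- the ground set -/
  E : Set α
  /-- the feasible sets -/
  Feasible : Set α → Prop
  finite_ground : E.Finite
  subset_ground : ∀ F, Feasible F → F ⊆ E
  exists_feasible : ∃ F, Feasible F
  symm_exchange : ∀ F₁ F₂, Feasible F₁ → Feasible F₂ → ∀ x ∈ F₁ ∆ F₂,
    ∃ y ∈ F₁ ∆ F₂, Feasible (F₁ ∆ {x, y})

namespace DeltaMatroid

variable {α : Type*}

/-- A delta-matroid is even if the sizes of its feasible sets all have the same parity. -/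
def IsEven (D : DeltaMatroid α) : Prop :=
  ∀ F₁ F₂, D.Feasible F₁ → D.Feasible F₂ → (Even F₁.ncard ↔ Even F₂.ncard)

/-- The direct sum of two delta-matroids with disjoint ground sets. -/
def directSum (D₁ D₂ : DeltaMatroid α) (h : Disjoint D₁.E D₂.E) : DeltaMatroid α where
  E := D₁.E ∪ D₂.E
  Feasible F := ∃ F₁ F₂, D₁.Feasible F₁ ∧ D₂.Feasible F₂ ∧ F = F₁ ∪ F₂
  finite_ground := D₁.finite_ground.union D₂.finite_ground
  subset_ground := by
    rintro _ ⟨F₁, F₂, h₁, h₂, rfl⟩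
    exact union_subset_union (D₁.subset_ground _ h₁) (D₂.subset_ground _ h₂)
  exists_feasible := by
    obtain ⟨F₁, h₁⟩ := D₁.exists_feasible
    obtain ⟨F₂, h₂⟩ := D₂.exists_feasible
    exact ⟨_, F₁, F₂, h₁, h₂, rfl⟩
  symm_exchange := by
    rintro _ _ ⟨F₁, F₂, h₁, h₂, rfl⟩ ⟨G₁, G₂, k₁, k₂, rfl⟩ x hx
    have a₁ := D₁.subset_ground _ h₁
    have a₂ := D₂.subset_ground _ h₂
    have b₁ := D₁.subset_ground _ k₁
    have b₂ := D₂.subset_ground _ k₂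
    have hd : ∀ z, z ∈ D₁.E → z ∉ D₂.E := fun z hz hz' => Set.disjoint_left.1 h hz hz'
    have hx' : x ∈ F₁ ∆ G₁ ∨ x ∈ F₂ ∆ G₂ := by
      simp only [Set.mem_symmDiff, Set.mem_union] at hx ⊢
      tauto
    rcases hx' with hx' | hx'
    · obtain ⟨y, hy, hF⟩ := D₁.symm_exchange _ _ h₁ k₁ x hx'
      have hxE : x ∈ D₁.E := by
        rcases hx' with q | q
        exacts [a₁ q.1, b₁ q.1]
      have hyE : y ∈ D₁.E := by
        rcases hy with q | q
        exacts [a₁ q.1, b₁ q.1]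
      have c₁ : y ∉ F₂ := fun q => hd y hyE (a₂ q)
      have c₂ : y ∉ G₂ := fun q => hd y hyE (b₂ q)
      refine ⟨y, ?_, F₁ ∆ {x, y}, F₂, hF, h₂, ?_⟩
      · simp only [Set.mem_symmDiff, Set.mem_union] at hy ⊢
        tauto
      · ext z
        have d₁ : z = x → z ∉ F₂ := by
          rintro rfl q
          exact hd _ hxE (a₂ q)
        have d₂ : z = y → z ∉ F₂ := by
          rintro rfl q
          exact c₁ q
        simp only [Set.mem_symmDiff, Set.mem_union, Set.mem_insert_iff, Set.mem_singleton_iff]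
        tauto
    · obtain ⟨y, hy, hF⟩ := D₂.symm_exchange _ _ h₂ k₂ x hx'
      have hxE : x ∈ D₂.E := by
        rcases hx' with q | q
        exacts [a₂ q.1, b₂ q.1]
      have hyE : y ∈ D₂.E := by
        rcases hy with q | q
        exacts [a₂ q.1, b₂ q.1]
      have c₁ : y ∉ F₁ := fun q => hd y (a₁ q) hyE
      have c₂ : y ∉ G₁ := fun q => hd y (b₁ q) hyE
      refine ⟨y, ?_, F₁, F₂ ∆ {x, y}, h₁, hF, ?_⟩
      · simp only [Set.mem_symmDiff, Set.mem_union] at hy ⊢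
        tauto
      · ext z
        have d₁ : z = x → z ∉ F₁ := by
          rintro rfl q
          exact hd _ (a₁ q) hxE
        have d₂ : z = y → z ∉ F₁ := by
          rintro rfl q
          exact c₁ q
        simp only [Set.mem_symmDiff, Set.mem_union, Set.mem_insert_iff, Set.mem_singleton_iff]
        tauto

/-- `X` is a separator of `D` if it is the ground set of one of the summands in a decomposition
of `D` as a direct sum. -/
def IsSeparator (D : DeltaMatroid α) (X : Set α) : Prop :=
  ∃ (D₁ D₂ : DeltaMatroid α) (h : Disjoint D₁.E D₂.E),
    D = directSum D₁ D₂ h ∧ (X = D₁.E ∨ X = D₂.E)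

/-- A separator of `D` is proper if it is neither empty nor the whole ground set. -/
def IsProperSeparator (D : DeltaMatroid α) (X : Set α) : Prop :=
  D.IsSeparator X ∧ X ≠ ∅ ∧ X ≠ D.E

/-- A delta-matroid is connected if it has no proper separator. -/
def IsConnected (D : DeltaMatroid α) : Prop :=
  ¬ ∃ X, D.IsProperSeparator X

/-- An element `e` of the ground set is a loop of `D` if it is in no feasible set (only used for
`e ∈ D.E`). -/
def IsLoop (D : DeltaMatroid α) (e : α) : Prop := ∀ F, D.Feasible F → e ∉ F

/-- An element `e` of the ground set is a coloop of `D` if it is in every feasible set. -/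
def IsColoop (D : DeltaMatroid α) (e : α) : Prop := ∀ F, D.Feasible F → e ∈ F

theorem IsColoop.not_isLoop {D : DeltaMatroid α} {e : α} (h : D.IsColoop e) : ¬ D.IsLoop e := by
  obtain ⟨F, hF⟩ := D.exists_feasible
  exact fun h' => h' F hF (h F hF)

/-- Deletion of an element that is not a coloop: the feasible sets are the feasible sets of `D`
that avoid `e`. -/
def deleteOfNotColoop (D : DeltaMatroid α) (e : α) (he : ¬ D.IsColoop e) : DeltaMatroid α where
  E := D.E \ {e}
  Feasible F := D.Feasible F ∧ F ⊆ D.E \ {e}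
  finite_ground := D.finite_ground.sdiff
  subset_ground := fun _ h => h.2
  exists_feasible := by
    simp only [IsColoop, not_forall] at he
    obtain ⟨F, hF, heF⟩ := he
    exact ⟨F, hF, fun z hz => ⟨D.subset_ground _ hF hz, fun hze => heF (hze ▸ hz)⟩⟩
  symm_exchange := by
    rintro F₁ F₂ ⟨h₁, s₁⟩ ⟨h₂, s₂⟩ x hx
    obtain ⟨y, hy, hF⟩ := D.symm_exchange _ _ h₁ h₂ x hx
    have key : ∀ z, z ∈ F₁ ∆ F₂ → z ∈ D.E \ {e} := by
      rintro z (q | q)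
      exacts [s₁ q.1, s₂ q.1]
    refine ⟨y, hy, hF, ?_⟩
    rintro z (q | q)
    · exact s₁ q.1
    · rcases q.1 with rfl | q'
      · exact key _ hx
      · exact (Set.mem_singleton_iff.1 q') ▸ key _ hy

/-- Contraction of an element that is not a loop: the feasible sets are the sets `F - e`, where `F`
is a feasible set of `D` that contains `e`. -/
def contractOfNotLoop (D : DeltaMatroid α) (e : α) (he : ¬ D.IsLoop e) : DeltaMatroid α where
  E := D.E \ {e}
  Feasible F := ∃ F', D.Feasible F' ∧ e ∈ F' ∧ F = F' \ {e}
  finite_ground := D.finite_ground.sdiff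
  subset_ground := by
    rintro _ ⟨F', h, -, rfl⟩
    exact sdiff_subset_sdiff_left (D.subset_ground _ h)
  exists_feasible := by
    simp only [IsLoop, not_forall, not_not] at he
    obtain ⟨F, hF, heF⟩ := he
    exact ⟨_, F, hF, heF, rfl⟩
  symm_exchange := by
    rintro _ _ ⟨F₁, h₁, e₁, rfl⟩ ⟨F₂, h₂, e₂, rfl⟩ x hx
    have hs : (F₁ \ {e}) ∆ (F₂ \ {e}) = F₁ ∆ F₂ := by
      ext z
      have d : z = e → z ∈ F₁ ∧ z ∈ F₂ := by
        rintro rfl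
        exact ⟨e₁, e₂⟩
      simp only [Set.mem_symmDiff, Set.mem_sdiff, Set.mem_singleton_iff]
      tauto
    have key : ∀ z, z ∈ F₁ ∆ F₂ → e ≠ z := by
      rintro z hz rfl
      simp only [Set.mem_symmDiff] at hz
      tauto
    rw [hs] at hx ⊢
    obtain ⟨y, hy, hF⟩ := D.symm_exchange _ _ h₁ h₂ x hx
    have hx' := key x hx
    have hy' := key y hy
    refine ⟨y, hy, _, hF, ?_, ?_⟩
    · simp only [Set.mem_symmDiff, Set.mem_insert_iff, Set.mem_singleton_iff]
      tauto
    · ext z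
      have d : z = e → z ≠ x ∧ z ≠ y := by
        rintro rfl
        exact ⟨hx', hy'⟩
      simp only [Set.mem_symmDiff, Set.mem_sdiff, Set.mem_insert_iff, Set.mem_singleton_iff]
      tauto

open Classical in
/-- The deletion `D \ e`; if `e` is a coloop then `D \ e = D / e`. -/
noncomputable def delete (D : DeltaMatroid α) (e : α) : DeltaMatroid α :=
  if h : D.IsColoop e then D.contractOfNotLoop e h.not_isLoop else D.deleteOfNotColoop e h

open Classical in
/-- The contraction `D / e`; if `e` is a loop then `D / e = D \ e`. -/
noncomputable def contract (D : DeltaMatroid α) (e : α) : DeltaMatroid α :=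
  if h : D.IsLoop e then D.deleteOfNotColoop e fun h' => h'.not_isLoop h
  else D.contractOfNotLoop e h

/-- `D.HasMinor D'` says that `D'` is a minor of `D`: it is obtained from `D` by a (possibly empty)
sequence of deletions and contractions of elements. -/
inductive HasMinor (D : DeltaMatroid α) : DeltaMatroid α → Prop
  | refl : HasMinor D D
  | delete {D' : DeltaMatroid α} (e : α) (he : e ∈ D'.E) (h : HasMinor D D') :
      HasMinor D (D'.delete e)
  | contract {D' : DeltaMatroid α} (e : α) (he : e ∈ D'.E) (h : HasMinor D D') :
      HasMinor D (D'.contract e)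

end DeltaMatroid

/-- A matroid is connected if it is not the direct sum of two matroids with non-empty
ground sets. -/
def MatroidConnected {α : Type*} (M : Matroid α) : Prop :=
  ¬ ∃ (M₁ M₂ : Matroid α) (h : Disjoint M₁.E M₂.E),
    M₁.E.Nonempty ∧ M₂.E.Nonempty ∧ M = M₁.disjointSum M₂ h

/-!
For a feasible set `F` of an even delta-matroid `D`, let `G_F` be the graph on the ground set in
which `x` and `y` are adjacent if `F ∆ {x, y}` is feasible. Everything rests on a parity criterion:
`X` is a separator of `D` if and only if all feasible sets meet `X` in sets of the same parity
(`IsSeparator.paritySep`, `ParitySep.feasible_mix`, `isSeparator_of_mix`), and for this it suffices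
that no edge of a single `G_F` joins `X` to its complement (`NoCrossing.paritySep`).

The minors of `D` with ground set `S` are exactly the delta-matroids
`{F ⊆ S | F ∪ Z is feasible in D}` with `Z ⊆ D.E \ S` (`HasMinor.exists_isSliceOf`,
`IsSliceOf.hasMinor`). Twisting by `e` exchanges deletion and contraction of `e`, so one may assume
`e ∉ Z`, that is, `D'` is a minor of `D.delete e`. If `D.delete e` is disconnected, then, since `D'`
is connected, `D.delete e` has a proper separator `A` that contains the ground set of `D'`. As `D`
is connected, `e` has neighbours both in `A` and outside `A` in `G_F` for every feasible `F` that
avoids `e`.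

* Then `D.contract e` is connected: a separator that contains a neighbour of `e` on one side of `A`
  contains the whole other side (`IsConnected.sdiff_subset_of_paritySep_contract`).
* If `b ∉ A` is a neighbour of `e`, then `Z ∆ {e, b}` defines the same minor `D'` as `Z` does
  (`IsSliceOf.exchange_of_paritySep_delete`), and since it contains `e`, `D'` is a minor of
  `D.contract e`.

For matroids, the bases of a finite matroid form an even delta-matroid with the same deletions,
contractions, minors and connectedness (`Matroid.toDeltaMatroid_delete`,
`Matroid.toDeltaMatroid_contract`, `Matroid.hasMinor_toDeltaMatroid_iff`,
`Matroid.matroidConnected_iff`).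
-/

/-! ### Parity of symmetric differences -/

theorem Set.even_ncard_symmDiff {α : Type*} {S T : Set α} (hS : S.Finite) (hT : T.Finite) :
    Even (S ∆ T).ncard ↔ (Even S.ncard ↔ Even T.ncard) := by
  have h1 : (S ∆ T).ncard = (S \ T).ncard + (T \ S).ncard :=
    ncard_union_eq disjoint_sdiff_sdiff hS.sdiff hT.sdiff
  have h2 := ncard_inter_add_ncard_sdiff_eq_ncard S T hS
  have h3 := ncard_inter_add_ncard_sdiff_eq_ncard T S hT
  rw [inter_comm] at h3
  rw [h1, ← h2, ← h3]
  simp only [Nat.even_add]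
  tauto

theorem Set.even_ncard_pair_inter {α : Type*} {x y : α} (X : Set α) (hxy : x ≠ y) :
    Even (({x, y} : Set α) ∩ X).ncard ↔ (x ∈ X ↔ y ∈ X) := by
  by_cases hx : x ∈ X <;> by_cases hy : y ∈ X
  · rw [inter_eq_left.2 (by rintro z (rfl | rfl) <;> assumption), ncard_pair hxy]; simp [hx, hy]
  · rw [insert_inter_of_mem hx, singleton_inter_eq_empty.2 hy]; simp [hx, hy]
  · rw [insert_inter_of_notMem hx, singleton_inter_of_mem hy]; simp [hx, hy]
  · rw [insert_inter_of_notMem hx, singleton_inter_eq_empty.2 hy]; simp [hx, hy]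

namespace DeltaMatroid

variable {α : Type*} {D D' : DeltaMatroid α} {F F₁ F₂ X Y Z : Set α} {e x y : α}

theorem Feasible.finite (hF : D.Feasible F) : F.Finite :=
  D.finite_ground.subset (D.subset_ground F hF)

theorem IsEven.even_symmDiff (hD : D.IsEven) (h₁ : D.Feasible F₁) (h₂ : D.Feasible F₂) :
    Even (F₁ ∆ F₂).ncard :=
  (even_ncard_symmDiff (Feasible.finite h₁) (Feasible.finite h₂)).2 (hD _ _ h₁ h₂)

theorem IsEven.exists_ne (hD : D.IsEven) (h₁ : D.Feasible F₁) (h₂ : D.Feasible F₂)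
    (hx : x ∈ F₁ ∆ F₂) : ∃ y ∈ F₁ ∆ F₂, x ≠ y ∧ D.Feasible (F₁ ∆ {x, y}) := by
  obtain ⟨y, hy, hF⟩ := D.symm_exchange _ _ h₁ h₂ x hx
  refine ⟨y, hy, ?_, hF⟩
  rintro rfl
  have := hD.even_symmDiff h₁ hF
  rw [symmDiff_symmDiff_cancel_left] at this
  simp at this

/-! ### Separators of even delta-matroids -/

/-- All feasible sets of `D` meet `X` in sets of the same parity. -/
def ParitySep (D : DeltaMatroid α) (X : Set α) : Prop :=
  ∀ ⦃F₁ F₂⦄, D.Feasible F₁ → D.Feasible F₂ → Even ((F₁ ∆ F₂) ∩ X).ncard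

/-- In the fundamental graph of `D` at the feasible set `F`, in which `u` and `v` are adjacent
if `F ∆ {u, v}` is feasible, no edge joins `X` to its complement. -/
def NoCrossing (D : DeltaMatroid α) (F X : Set α) : Prop :=
  ∀ ⦃u v⦄, u ∈ X → v ∉ X → ¬ D.Feasible (F ∆ {u, v})

theorem ParitySep.mem_iff (hX : D.ParitySep X) (hF : D.Feasible F)
    (hF' : D.Feasible (F ∆ {x, y})) : x ∈ X ↔ y ∈ X := by
  by_cases hxy : x = y
  · rw [hxy]
  · have := hX hF hF'
    rwa [symmDiff_symmDiff_cancel_left, even_ncard_pair_inter X hxy] at this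

theorem ParitySep.compl (hD : D.IsEven) (hX : D.ParitySep X) : D.ParitySep Xᶜ := by
  intro F₁ F₂ h₁ h₂
  have hfin : (F₁ ∆ F₂).Finite := (Feasible.finite h₁).symmDiff (Feasible.finite h₂)
  have h := ncard_inter_add_ncard_sdiff_eq_ncard (F₁ ∆ F₂) X hfin
  have h' := hD.even_symmDiff h₁ h₂
  rw [← h, Nat.even_add] at h'
  rw [← sdiff_eq]
  exact h'.1 (hX h₁ h₂)

theorem ParitySep.of_inter_ground (hX : D.ParitySep X) (h : X ∩ D.E = Y ∩ D.E) :
    D.ParitySep Y := by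
  intro F₁ F₂ h₁ h₂
  have hs : F₁ ∆ F₂ ⊆ D.E :=
    symmDiff_subset_union.trans (union_subset (D.subset_ground _ h₁) (D.subset_ground _ h₂))
  have := hX h₁ h₂
  rwa [← inter_eq_left.2 hs, inter_assoc, inter_comm D.E, ← h, inter_comm X, ← inter_assoc,
    inter_assoc, inter_comm D.E, ← inter_assoc, inter_right_comm, inter_eq_left.2 hs]

/-- A set that is not crossed at `F` is met in an even set by `F ∆ F'` if `F'` is close to `F`: one
of the two parts of `F ∆ F'` would be a singleton `{v}`, and exchanging `v` would give a crossing
pair. -/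
theorem NoCrossing.even_of_ncard_le_four (hD : D.IsEven) (hX : D.NoCrossing F X)
    (hF : D.Feasible F) (hF₁ : D.Feasible F₁) (hle : (F ∆ F₁).ncard ≤ 4) :
    Even ((F ∆ F₁) ∩ X).ncard := by
  by_contra hodd
  have hfin : (F ∆ F₁).Finite := (Feasible.finite hF).symmDiff (Feasible.finite hF₁)
  have h := ncard_inter_add_ncard_sdiff_eq_ncard (F ∆ F₁) X hfin
  have h' := hD.even_symmDiff hF hF₁
  have hcases : ((F ∆ F₁) ∩ X).ncard = 1 ∨ ((F ∆ F₁) \ X).ncard = 1 := by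
    rw [Nat.even_iff] at hodd h'
    omega
  rcases hcases with h1 | h1 <;> obtain ⟨v, hv⟩ := ncard_eq_one.1 h1
  · have hvm : v ∈ (F ∆ F₁) ∩ X := hv ▸ mem_singleton v
    obtain ⟨y, hy, hne, hFy⟩ := hD.exists_ne hF hF₁ hvm.1
    refine hX hvm.2 (fun hyX => hne ?_) hFy
    exact (mem_singleton_iff.1 (hv ▸ (⟨hy, hyX⟩ : y ∈ (F ∆ F₁) ∩ X))).symm
  · have hvm : v ∈ (F ∆ F₁) \ X := hv ▸ mem_singleton v
    obtain ⟨y, hy, hne, hFy⟩ := hD.exists_ne hF hF₁ hvm.1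
    rw [pair_comm] at hFy
    refine hX (by_contra fun hyX => hne ?_) hvm.2 hFy
    exact (mem_singleton_iff.1 (hv ▸ (⟨hy, hyX⟩ : y ∈ (F ∆ F₁) \ X))).symm

/-- Absence of crossing pairs is preserved by an exchange of two elements. -/
theorem NoCrossing.exchange (hD : D.IsEven) (hX : D.NoCrossing F X) (hF : D.Feasible F)
    (hxy : x ≠ y) (hF' : D.Feasible (F ∆ {x, y})) : D.NoCrossing (F ∆ {x, y}) X := by
  intro u v hu hv huv
  have hxyX : x ∈ X ↔ y ∈ X := by
    by_cases hx : x ∈ X <;> by_cases hy : y ∈ X <;> simp only [hx, hy]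
    · exact (hX hx hy hF').elim
    · exact (hX hy hx (pair_comm x y ▸ hF')).elim
  have huv' : u ≠ v := fun h => hv (h ▸ hu)
  have hfin : ∀ a b : α, ({a, b} : Set α).Finite := fun a b => (finite_singleton b).insert a
  have heq : F ∆ ((F ∆ {x, y}) ∆ {u, v}) = {x, y} ∆ {u, v} := by
    rw [symmDiff_assoc, symmDiff_symmDiff_cancel_left]
  have hle : (F ∆ ((F ∆ {x, y}) ∆ {u, v})).ncard ≤ 4 := by
    rw [heq]
    refine (ncard_le_ncard symmDiff_subset_union ((hfin _ _).union (hfin _ _))).trans ?_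
    refine (ncard_union_le _ _).trans ?_
    rw [ncard_pair hxy, ncard_pair huv']
  have := hX.even_of_ncard_le_four hD hF huv hle
  rw [heq, inter_symmDiff_distrib_right, even_ncard_symmDiff ((hfin _ _).inter_of_left _)
    ((hfin _ _).inter_of_left _), even_ncard_pair_inter X hxy, even_ncard_pair_inter X huv'] at this
  tauto

/-- The separators of an even delta-matroid can be read off from a single fundamental graph. -/
theorem NoCrossing.paritySep (hD : D.IsEven) (hX : D.NoCrossing F X) (hF : D.Feasible F) :
    D.ParitySep X := by
  have key : ∀ n F F₁, D.NoCrossing F X → D.Feasible F → D.Feasible F₁ → (F ∆ F₁).ncard = n →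
      Even ((F ∆ F₁) ∩ X).ncard := by
    intro n
    induction n using Nat.strong_induction_on with
    | _ n ih =>
      intro F F₁ hX hF hF₁ hn
      by_cases hle : (F ∆ F₁).ncard ≤ 4
      · exact hX.even_of_ncard_le_four hD hF hF₁ hle
      have hfin : (F ∆ F₁).Finite := (Feasible.finite hF).symmDiff (Feasible.finite hF₁)
      obtain ⟨x, hx⟩ : (F ∆ F₁).Nonempty := nonempty_of_ncard_ne_zero (by omega)
      obtain ⟨y, hy, hxy, hF'⟩ := hD.exists_ne hF hF₁ hx
      have hsub : ({x, y} : Set α) ⊆ F ∆ F₁ := by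
        rintro z (rfl | rfl) <;> assumption
      have heq : (F ∆ {x, y}) ∆ F₁ = (F ∆ F₁) \ {x, y} := by
        rw [symmDiff_right_comm, symmDiff_of_ge hsub]
      have hcard : ((F ∆ {x, y}) ∆ F₁).ncard < n := by
        rw [heq, ← hn]
        exact ncard_lt_ncard ⟨sdiff_subset, fun h => (h hx).2 (by simp)⟩ hfin
      have h1 := ih _ hcard _ _ (hX.exchange hD hF hxy hF') hF' hF₁ rfl
      have h2 := hX.even_of_ncard_le_four hD hF hF' (by
        rw [symmDiff_symmDiff_cancel_left, ncard_pair hxy]; norm_num)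
      have h3 : F ∆ F₁ = (F ∆ (F ∆ {x, y})) ∆ ((F ∆ {x, y}) ∆ F₁) := by
        rw [symmDiff_assoc, symmDiff_symmDiff_cancel_left]
      rw [h3, inter_symmDiff_distrib_right, even_ncard_symmDiff]
      · tauto
      · exact ((Feasible.finite hF).symmDiff (Feasible.finite hF')).inter_of_left _
      · exact ((Feasible.finite hF').symmDiff (Feasible.finite hF₁)).inter_of_left _
  intro F₁ F₂ h₁ h₂
  have h3 : F₁ ∆ F₂ = (F ∆ F₁) ∆ (F ∆ F₂) := by
    rw [symmDiff_comm F F₁, symmDiff_assoc, symmDiff_symmDiff_cancel_left]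
  rw [h3, inter_symmDiff_distrib_right, even_ncard_symmDiff]
  · simp [key _ F F₁ hX hF h₁ rfl, key _ F F₂ hX hF h₂ rfl]
  · exact ((Feasible.finite hF).symmDiff (Feasible.finite h₁)).inter_of_left _
  · exact ((Feasible.finite hF).symmDiff (Feasible.finite h₂)).inter_of_left _

/-- Feasible sets of an even delta-matroid can be mixed along a separator. -/
theorem ParitySep.feasible_mix (hX : D.ParitySep X) (h₁ : D.Feasible F₁)
    (h₂ : D.Feasible F₂) : D.Feasible ((F₁ ∩ X) ∪ (F₂ \ X)) := by
  induction hn : ((F₁ ∆ F₂) \ X).ncard using Nat.strong_induction_on generalizing F₁ with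
  | _ n ih =>
    have hfin : ((F₁ ∆ F₂) \ X).Finite :=
      ((Feasible.finite h₁).symmDiff (Feasible.finite h₂)).sdiff
    rcases ((F₁ ∆ F₂) \ X).eq_empty_or_nonempty with hemp | ⟨x, hx, hxX⟩
    · convert h₁ using 1
      ext z
      have := Set.ext_iff.1 hemp z
      simp only [Set.mem_symmDiff, Set.mem_sdiff, mem_empty_iff_false, iff_false] at this
      simp only [mem_union, mem_inter_iff, Set.mem_sdiff]
      tauto
    · obtain ⟨y, hy, hF⟩ := D.symm_exchange _ _ h₁ h₂ x hx
      have hyX : y ∉ X := fun h => hxX ((hX.mem_iff h₁ hF).2 h)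
      have hmix : (F₁ ∩ X) = (F₁ ∆ {x, y}) ∩ X := by
        ext z
        have d₁ : z = x → z ∉ X := by rintro rfl; exact hxX
        have d₂ : z = y → z ∉ X := by rintro rfl; exact hyX
        simp only [mem_inter_iff, Set.mem_symmDiff, Set.mem_insert_iff, Set.mem_singleton_iff]
        tauto
      rw [hmix]
      refine ih _ ?_ hF rfl
      rw [← hn]
      refine ncard_lt_ncard ⟨?_, fun h => ?_⟩ hfin
      · intro z
        have d₁ : z = x → z ∈ F₁ ∆ F₂ := by rintro rfl; exact hx
        have d₂ : z = y → z ∈ F₁ ∆ F₂ := by rintro rfl; exact hy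
        simp only [Set.mem_sdiff, Set.mem_symmDiff, Set.mem_insert_iff, Set.mem_singleton_iff]
          at d₁ d₂ ⊢
        tauto
      · have := (h ⟨hx, hxX⟩).1
        simp only [Set.mem_symmDiff, Set.mem_insert_iff, Set.mem_singleton_iff] at this hx
        tauto

end DeltaMatroid

namespace DeltaMatroid

variable {α : Type*} {D D' D'' : DeltaMatroid α} {F F₁ F₂ S X Y Z Z' : Set α} {e x y : α}

/-! ### Slices and connectedness -/

/-- The delta-matroid on `S` whose feasible sets are the sets `F ⊆ S` for which `F ∪ Z` is feasible
in `D`. If `Z ⊆ D.E \ S`, this is the minor obtained by contracting `Z` and deleting the other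
elements outside `S`. -/
def slice (D : DeltaMatroid α) (S Z : Set α) (hS : S ⊆ D.E) (hSZ : Disjoint S Z)
    (h : ∃ F ⊆ S, D.Feasible (F ∪ Z)) : DeltaMatroid α where
  E := S
  Feasible F := F ⊆ S ∧ D.Feasible (F ∪ Z)
  finite_ground := D.finite_ground.subset hS
  subset_ground := fun _ h => h.1
  exists_feasible := h
  symm_exchange := by
    rintro F₁ F₂ ⟨s₁, h₁⟩ ⟨s₂, h₂⟩ x hx
    have hd : ∀ z, z ∈ S → z ∉ Z := fun z hz hz' => Set.disjoint_left.1 hSZ hz hz'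
    have heq : (F₁ ∪ Z) ∆ (F₂ ∪ Z) = F₁ ∆ F₂ := by
      ext z
      have a₁ := @s₁ z
      have a₂ := @s₂ z
      have a₃ := hd z
      simp only [Set.mem_symmDiff, mem_union]
      tauto
    have hsub : F₁ ∆ F₂ ⊆ S := symmDiff_subset_union.trans (union_subset s₁ s₂)
    obtain ⟨y, hy, hF⟩ := D.symm_exchange _ _ h₁ h₂ x (heq ▸ hx)
    rw [heq] at hy
    have hpair : ({x, y} : Set α) ⊆ S := by
      rintro z (rfl | rfl)
      exacts [hsub hx, hsub hy]
    refine ⟨y, hy, symmDiff_subset_union.trans (union_subset s₁ hpair), ?_⟩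
    convert hF using 1
    ext z
    have a₁ := @hpair z
    have a₂ := hd z
    simp only [Set.mem_symmDiff, mem_union]
    tauto

theorem IsSeparator.paritySep (hD : D.IsEven) (hX : D.IsSeparator X) : D.ParitySep X := by
  have key : ∀ D₁ D₂ D₃ : DeltaMatroid α, Disjoint D₁.E D₂.E → D₃.IsEven →
      (∀ F, D₃.Feasible F ↔ ∃ F₁ F₂, D₁.Feasible F₁ ∧ D₂.Feasible F₂ ∧ F = F₁ ∪ F₂) →
      D₃.ParitySep D₁.E := by
    intro D₁ D₂ D₃ hd hev hfeas F G hF hG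
    obtain ⟨F₁, F₂, hF₁, hF₂, rfl⟩ := (hfeas _).1 hF
    obtain ⟨G₁, G₂, hG₁, hG₂, rfl⟩ := (hfeas _).1 hG
    have h := hev.even_symmDiff ((hfeas _).2 ⟨_, _, hF₁, hF₂, rfl⟩)
      ((hfeas _).2 ⟨_, _, hG₁, hF₂, rfl⟩)
    convert h using 2
    ext z
    have a₁ : z ∈ F₁ → z ∈ D₁.E := fun h => D₁.subset_ground _ hF₁ h
    have a₂ : z ∈ F₂ → z ∈ D₂.E := fun h => D₂.subset_ground _ hF₂ h
    have a₃ : z ∈ G₁ → z ∈ D₁.E := fun h => D₁.subset_ground _ hG₁ h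
    have a₄ : z ∈ G₂ → z ∈ D₂.E := fun h => D₂.subset_ground _ hG₂ h
    have a₅ : z ∈ D₁.E → z ∉ D₂.E := fun h h' => Set.disjoint_left.1 hd h h'
    simp only [Set.mem_symmDiff, mem_union, mem_inter_iff]
    tauto
  obtain ⟨D₁, D₂, h, rfl, rfl | rfl⟩ := hX
  · exact key D₁ D₂ _ h hD fun F => Iff.rfl
  · refine key D₂ D₁ _ h.symm hD fun F => ⟨?_, ?_⟩
    · rintro ⟨F₁, F₂, h₁, h₂, rfl⟩
      exact ⟨F₂, F₁, h₂, h₁, union_comm _ _⟩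
    · rintro ⟨F₁, F₂, h₁, h₂, rfl⟩
      exact ⟨F₂, F₁, h₂, h₁, union_comm _ _⟩

/-- A set along which feasible sets can be mixed splits `D` as a direct sum of two slices. -/
theorem isSeparator_of_mix (hX : X ⊆ D.E)
    (hmix : ∀ F₁ F₂, D.Feasible F₁ → D.Feasible F₂ → D.Feasible ((F₁ ∩ X) ∪ (F₂ \ X))) :
    D.IsSeparator X := by
  obtain ⟨F₀, hF₀⟩ := D.exists_feasible
  have hF₀E := D.subset_ground _ hF₀
  refine ⟨D.slice X (F₀ \ X) hX disjoint_sdiff_right ⟨F₀ ∩ X, inter_subset_right, ?_⟩,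
    D.slice (D.E \ X) (F₀ ∩ X) sdiff_subset
      (disjoint_sdiff_left.mono_right inter_subset_right)
      ⟨F₀ \ X, sdiff_subset_sdiff_left hF₀E, ?_⟩, disjoint_sdiff_right, ?_, Or.inl rfl⟩
  · rwa [inter_union_sdiff]
  · rwa [union_comm, inter_union_sdiff]
  · refine DeltaMatroid.ext (union_sdiff_cancel hX).symm (funext fun F => propext ⟨?_, ?_⟩)
    · intro hF
      refine ⟨F ∩ X, F \ X, ⟨inter_subset_right, hmix _ _ hF hF₀⟩,
        ⟨sdiff_subset_sdiff_left (D.subset_ground _ hF), ?_⟩, (inter_union_sdiff _ _).symm⟩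
      rw [union_comm]
      exact hmix _ _ hF₀ hF
    · rintro ⟨F₁, F₂, ⟨s₁, h₁⟩, ⟨s₂, h₂⟩, rfl⟩
      convert hmix _ _ h₁ h₂ using 1
      ext z
      have a₁ := @s₁ z
      have a₂ := @s₂ z
      simp only [mem_union, mem_inter_iff, Set.mem_sdiff] at a₂ ⊢
      tauto

theorem IsEven.isConnected_iff (hD : D.IsEven) :
    D.IsConnected ↔ ∀ X ⊆ D.E, D.ParitySep X → X = ∅ ∨ X = D.E := by
  refine ⟨fun h X hXE hX => ?_, ?_⟩
  · by_contra! hne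
    exact h ⟨X, isSeparator_of_mix hXE fun _ _ => hX.feasible_mix, nonempty_iff_ne_empty.1 hne.1,
      hne.2⟩
  · rintro h ⟨X, hX, h₁, h₂⟩
    have hXE : X ⊆ D.E := by
      obtain ⟨D₁, D₂, -, rfl, rfl | rfl⟩ := hX
      exacts [subset_union_left, subset_union_right]
    exact (h X hXE (hX.paritySep hD)).elim h₁ h₂

/-! ### Minors as slices -/

/-- `D'` is the slice of `D` on the ground set of `D'` at `Z`: the minor of `D` that arises by
contracting `Z` and deleting the other elements outside `D'.E`. -/
structure IsSliceOf (D' D : DeltaMatroid α) (Z : Set α) : Prop where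
  subset : D'.E ⊆ D.E
  subset_sdiff : Z ⊆ D.E \ D'.E
  feasible_iff : ∀ F ⊆ D'.E, (D'.Feasible F ↔ D.Feasible (F ∪ Z))

theorem IsSliceOf.feasible_union (h : D'.IsSliceOf D Z) (hF : D'.Feasible F) :
    D.Feasible (F ∪ Z) :=
  (h.feasible_iff F (D'.subset_ground F hF)).1 hF

theorem IsSliceOf.refl (D : DeltaMatroid α) : D.IsSliceOf D ∅ :=
  ⟨Subset.rfl, empty_subset _, fun F _ => by rw [union_empty]⟩

theorem IsSliceOf.trans (h' : D''.IsSliceOf D' Z') (h : D'.IsSliceOf D Z) :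
    D''.IsSliceOf D (Z' ∪ Z) := by
  refine ⟨h'.subset.trans h.subset, union_subset ?_ ?_, fun F hF => ?_⟩
  · exact h'.subset_sdiff.trans (sdiff_subset_sdiff_left h.subset)
  · exact h.subset_sdiff.trans (sdiff_subset_sdiff_right h'.subset)
  · rw [h'.feasible_iff F hF, h.feasible_iff _
      (union_subset (hF.trans h'.subset) (h'.subset_sdiff.trans sdiff_subset)), union_assoc]

theorem IsSliceOf.symmDiff_eq (h : D'.IsSliceOf D Z) (h₁ : D'.Feasible F₁)
    (h₂ : D'.Feasible F₂) : (F₁ ∪ Z) ∆ (F₂ ∪ Z) = F₁ ∆ F₂ := by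
  ext z
  have a₁ : z ∈ F₁ → z ∈ D'.E := fun h => D'.subset_ground _ h₁ h
  have a₂ : z ∈ F₂ → z ∈ D'.E := fun h => D'.subset_ground _ h₂ h
  have a₃ := @h.subset_sdiff z
  simp only [Set.mem_sdiff, Set.mem_symmDiff, mem_union] at a₃ ⊢
  tauto

theorem IsSliceOf.isEven (h : D'.IsSliceOf D Z) (hD : D.IsEven) : D'.IsEven := by
  intro F₁ F₂ h₁ h₂
  rw [← even_ncard_symmDiff (Feasible.finite h₁) (Feasible.finite h₂), ← h.symmDiff_eq h₁ h₂]
  exact hD.even_symmDiff (h.feasible_union h₁) (h.feasible_union h₂)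

theorem IsSliceOf.paritySep (h : D'.IsSliceOf D Z) (hX : D.ParitySep X) : D'.ParitySep X := by
  intro F₁ F₂ h₁ h₂
  rw [← h.symmDiff_eq h₁ h₂]
  exact hX (h.feasible_union h₁) (h.feasible_union h₂)

theorem delete_of_isColoop (h : D.IsColoop e) : D.delete e = D.contract e := by
  rw [delete, contract, dif_pos h, dif_neg h.not_isLoop]

theorem contract_of_isLoop (h : D.IsLoop e) : D.contract e = D.delete e := by
  rw [delete, contract, dif_pos h, dif_neg fun h' => h'.not_isLoop h]

theorem delete_ground (D : DeltaMatroid α) (e : α) : (D.delete e).E = D.E \ {e} := by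
  rw [delete]; split <;> rfl

theorem contract_ground (D : DeltaMatroid α) (e : α) : (D.contract e).E = D.E \ {e} := by
  rw [contract]; split <;> rfl

theorem delete_feasible_iff (h : ¬ D.IsColoop e) :
    (D.delete e).Feasible F ↔ D.Feasible F ∧ e ∉ F := by
  rw [delete, dif_neg h]
  refine and_congr_right fun hF => ⟨fun hs he => (hs he).2 rfl, fun he z hz => ?_⟩
  exact ⟨D.subset_ground F hF hz, fun hze => he (hze ▸ hz)⟩

theorem contract_feasible_iff (h : ¬ D.IsLoop e) :
    (D.contract e).Feasible F ↔ D.Feasible (insert e F) ∧ e ∉ F := by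
  rw [contract, dif_neg h]
  constructor
  · rintro ⟨F', hF', he, rfl⟩
    exact ⟨by rwa [insert_sdiff_singleton, insert_eq_of_mem he], fun h => h.2 rfl⟩
  · rintro ⟨hF, he⟩
    exact ⟨_, hF, mem_insert e F, by rw [insert_sdiff_self_of_notMem he]⟩

theorem isSliceOf_delete (h : ¬ D.IsColoop e) : (D.delete e).IsSliceOf D ∅ := by
  refine ⟨by simp [delete_ground], empty_subset _, fun F hF => ?_⟩
  rw [delete_ground] at hF
  rw [delete_feasible_iff h, union_empty, and_iff_left]
  exact fun he => (hF he).2 rfl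

theorem isSliceOf_contract (he : e ∈ D.E) (h : ¬ D.IsLoop e) :
    (D.contract e).IsSliceOf D {e} := by
  refine ⟨by simp [contract_ground], by simp [contract_ground, he], fun F hF => ?_⟩
  rw [contract_ground] at hF
  rw [contract_feasible_iff h, union_singleton, and_iff_left]
  exact fun he => (hF he).2 rfl

theorem exists_isSliceOf_delete (he : e ∈ D.E) : ∃ Z, (D.delete e).IsSliceOf D Z := by
  by_cases h : D.IsColoop e
  · exact ⟨_, delete_of_isColoop h ▸ isSliceOf_contract he h.not_isLoop⟩
  · exact ⟨_, isSliceOf_delete h⟩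

theorem exists_isSliceOf_contract (he : e ∈ D.E) : ∃ Z, (D.contract e).IsSliceOf D Z := by
  by_cases h : D.IsLoop e
  · exact contract_of_isLoop h ▸ exists_isSliceOf_delete he
  · exact ⟨_, isSliceOf_contract he h⟩

theorem HasMinor.trans (h : D.HasMinor D') (h' : D'.HasMinor D'') : D.HasMinor D'' := by
  induction h' with
  | refl => exact h
  | delete e he _ ih => exact ih.delete e he
  | contract e he _ ih => exact ih.contract e he

theorem HasMinor.exists_isSliceOf (h : D.HasMinor D') : ∃ Z, D'.IsSliceOf D Z := by
  induction h with
  | refl => exact ⟨_, IsSliceOf.refl D⟩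
  | delete e he _ ih =>
    obtain ⟨Z, hZ⟩ := ih
    obtain ⟨Z', hZ'⟩ := exists_isSliceOf_delete he
    exact ⟨_, hZ'.trans hZ⟩
  | contract e he _ ih =>
    obtain ⟨Z, hZ⟩ := ih
    obtain ⟨Z', hZ'⟩ := exists_isSliceOf_contract he
    exact ⟨_, hZ'.trans hZ⟩

theorem IsSliceOf.not_isColoop (h : D'.IsSliceOf D Z) (he : e ∉ D'.E) (heZ : e ∉ Z) :
    ¬ D.IsColoop e := by
  obtain ⟨F, hF⟩ := D'.exists_feasible
  exact fun h' => (h' _ (h.feasible_union hF)).elim (fun h => he (D'.subset_ground F hF h)) heZ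

theorem IsSliceOf.not_isLoop (h : D'.IsSliceOf D Z) (heZ : e ∈ Z) : ¬ D.IsLoop e := by
  obtain ⟨F, hF⟩ := D'.exists_feasible
  exact fun h' => h' _ (h.feasible_union hF) (Or.inr heZ)

theorem IsSliceOf.delete (h : D'.IsSliceOf D Z) (he : e ∉ D'.E) (heZ : e ∉ Z) :
    D'.IsSliceOf (D.delete e) Z := by
  refine ⟨?_, ?_, fun F hF => ?_⟩
  · rw [delete_ground]
    exact fun z hz => ⟨h.subset hz, fun hze => he (hze ▸ hz)⟩
  · rw [delete_ground]
    exact fun z hz => ⟨⟨(h.subset_sdiff hz).1, fun hze => heZ (hze ▸ hz)⟩, (h.subset_sdiff hz).2⟩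
  · rw [delete_feasible_iff (h.not_isColoop he heZ), h.feasible_iff F hF, and_iff_left]
    exact fun h' => h'.elim (fun h' => he (hF h')) heZ

theorem IsSliceOf.contract (h : D'.IsSliceOf D Z) (heZ : e ∈ Z) :
    D'.IsSliceOf (D.contract e) (Z \ {e}) := by
  have he := (h.subset_sdiff heZ).2
  refine ⟨?_, ?_, fun F hF => ?_⟩
  · rw [contract_ground]
    exact fun z hz => ⟨h.subset hz, fun hze => he (hze ▸ hz)⟩
  · rw [contract_ground]
    exact fun z hz => ⟨⟨(h.subset_sdiff hz.1).1, hz.2⟩, (h.subset_sdiff hz.1).2⟩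
  · have heF : e ∉ F := fun h' => he (hF h')
    rw [contract_feasible_iff (h.not_isLoop heZ), h.feasible_iff F hF, and_iff_left (by simp [heF]),
      ← union_insert, insert_sdiff_singleton, insert_eq_of_mem heZ]

theorem IsSliceOf.hasMinor (h : D'.IsSliceOf D Z) : D.HasMinor D' := by
  induction hn : (D.E \ D'.E).ncard generalizing D Z with
  | zero =>
    have hsub : D.E \ D'.E = ∅ := (ncard_eq_zero D.finite_ground.sdiff).1 hn
    have hE : D'.E = D.E := h.subset.antisymm (sdiff_eq_empty.1 hsub)
    have hZ : Z = ∅ := subset_empty_iff.1 (hsub ▸ h.subset_sdiff)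
    have : D' = D := DeltaMatroid.ext hE <| funext fun F => propext
      ⟨fun hF => by simpa [hZ] using h.feasible_union hF, fun hF => by
        rw [h.feasible_iff F (hE ▸ D.subset_ground F hF), hZ, union_empty]; exact hF⟩
    exact this ▸ HasMinor.refl
  | succ n ih =>
    obtain ⟨e, he, he'⟩ : (D.E \ D'.E).Nonempty := nonempty_of_ncard_ne_zero (by omega)
    have hcard : ((D.E \ {e}) \ D'.E).ncard = n := by
      rw [sdiff_sdiff_comm, ncard_sdiff_singleton_of_mem (show e ∈ D.E \ D'.E from ⟨he, he'⟩), hn]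
      rfl
    by_cases heZ : e ∈ Z
    · exact (HasMinor.refl.contract e he).trans
        (ih (h.contract heZ) (by rw [contract_ground, hcard]))
    · exact (HasMinor.refl.delete e he).trans
        (ih (h.delete he' heZ) (by rw [delete_ground, hcard]))

end DeltaMatroid

namespace DeltaMatroid

variable {α : Type*} {D D' : DeltaMatroid α} {F F₁ F₂ A X Y Z : Set α} {a b e x y z : α}

theorem pair_symmDiff_pair (hxy : x ≠ y) (hxz : x ≠ z) (hyz : y ≠ z) :
    ({x, y} : Set α) ∆ {x, z} = {y, z} := by
  ext w
  simp only [Set.mem_symmDiff, Set.mem_insert_iff, Set.mem_singleton_iff]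
  grind

/-! ### Twisting -/

theorem isEven_of_even_symmDiff
    (h : ∀ F₁ F₂, D.Feasible F₁ → D.Feasible F₂ → Even (F₁ ∆ F₂).ncard) : D.IsEven :=
  fun F₁ F₂ h₁ h₂ =>
    (even_ncard_symmDiff (Feasible.finite h₁) (Feasible.finite h₂)).1 (h F₁ F₂ h₁ h₂)

theorem symmDiff_twist_twist (F₁ F₂ : Set α) (e : α) : (F₁ ∆ {e}) ∆ (F₂ ∆ {e}) = F₁ ∆ F₂ := by
  rw [symmDiff_symmDiff_symmDiff_comm, symmDiff_self, symmDiff_bot]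

/-- The twist of `D` by the element `e`: its feasible sets are the sets `F ∆ {e}`, where `F` is
feasible in `D`. Twisting interchanges the roles of deletion and contraction of `e`. -/
def twist (D : DeltaMatroid α) (e : α) (he : e ∈ D.E) : DeltaMatroid α where
  E := D.E
  Feasible F := D.Feasible (F ∆ {e})
  finite_ground := D.finite_ground
  subset_ground := by
    intro F hF
    rw [← symmDiff_symmDiff_cancel_right {e} F]
    exact symmDiff_subset_union.trans
      (union_subset (D.subset_ground _ hF) (singleton_subset_iff.2 he))
  exists_feasible := by
    obtain ⟨F, hF⟩ := D.exists_feasible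
    exact ⟨F ∆ {e}, by rwa [symmDiff_symmDiff_cancel_right]⟩
  symm_exchange := by
    intro F₁ F₂ h₁ h₂ x hx
    obtain ⟨y, hy, hF⟩ := D.symm_exchange _ _ h₁ h₂ x ((symmDiff_twist_twist F₁ F₂ e).symm ▸ hx)
    exact ⟨y, symmDiff_twist_twist F₁ F₂ e ▸ hy, by rwa [symmDiff_right_comm]⟩

theorem twist_twist (he : e ∈ D.E) : (D.twist e he).twist e he = D :=
  DeltaMatroid.ext rfl (funext fun F => by simp [twist])

theorem IsEven.twist (hD : D.IsEven) (he : e ∈ D.E) : (D.twist e he).IsEven :=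
  isEven_of_even_symmDiff fun F₁ F₂ h₁ h₂ =>
    symmDiff_twist_twist F₁ F₂ e ▸ hD.even_symmDiff h₁ h₂

theorem IsConnected.twist (hc : D.IsConnected) (hD : D.IsEven) (he : e ∈ D.E) :
    (D.twist e he).IsConnected := by
  refine (hD.twist he).isConnected_iff.2 fun X hXE hX => hD.isConnected_iff.1 hc X hXE ?_
  intro F₁ F₂ h₁ h₂
  rw [← symmDiff_twist_twist F₁ F₂ e]
  refine hX ?_ ?_ <;> simpa [DeltaMatroid.twist]

theorem symmDiff_singleton_of_notMem (he : e ∉ F) : F ∆ {e} = insert e F := by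
  rw [(disjoint_singleton_right.2 he).symmDiff_eq_sup]
  exact union_singleton

theorem symmDiff_singleton_of_mem (he : e ∈ F) : F ∆ {e} = F \ {e} :=
  symmDiff_of_ge (singleton_subset_iff.2 he)

theorem isColoop_twist_iff (he : e ∈ D.E) : (D.twist e he).IsColoop e ↔ D.IsLoop e := by
  constructor
  · intro h F hF heF
    have := h (F ∆ {e}) (by simpa [twist])
    simp [Set.mem_symmDiff, heF] at this
  · intro h F hF
    by_contra heF
    exact h _ hF (by simp [Set.mem_symmDiff, heF])

theorem delete_twist (he : e ∈ D.E) : (D.twist e he).delete e = D.contract e := by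
  refine DeltaMatroid.ext (by rw [delete_ground, contract_ground]; rfl) (funext fun F => propext ?_)
  by_cases h : D.IsLoop e
  · have h' := (isColoop_twist_iff he).2 h
    rw [delete_of_isColoop h', contract_of_isLoop h, contract_feasible_iff h'.not_isLoop,
      delete_feasible_iff fun h' => h'.not_isLoop h]
    refine and_congr_left fun heF => ?_
    change D.Feasible _ ↔ _
    rw [symmDiff_singleton_of_mem (mem_insert e F), insert_sdiff_self_of_notMem heF]
  · rw [contract_feasible_iff h, delete_feasible_iff (by rwa [isColoop_twist_iff])]
    refine and_congr_left fun heF => ?_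
    change D.Feasible _ ↔ _
    rw [symmDiff_singleton_of_notMem heF]

theorem contract_twist (he : e ∈ D.E) : (D.twist e he).contract e = D.delete e := by
  rw [← delete_twist (D := D.twist e he) he, twist_twist]

theorem IsSliceOf.twist (h : D'.IsSliceOf D Z) (heZ : e ∈ Z) (he : e ∈ D.E) :
    D'.IsSliceOf (D.twist e he) (Z \ {e}) := by
  refine ⟨h.subset, sdiff_subset.trans h.subset_sdiff, fun F hF => ?_⟩
  have heF : e ∉ F := fun h' => (h.subset_sdiff heZ).2 (hF h')
  change _ ↔ D.Feasible _
  rw [h.feasible_iff F hF, symmDiff_singleton_of_notMem (by simp [heF]), ← union_insert,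
    insert_sdiff_singleton, insert_eq_of_mem heZ]

/-! ### Separators of single-element deletions and contractions -/

theorem ParitySep.even_of_delete (hX : (D.delete e).ParitySep X) (h₁ : D.Feasible F₁)
    (h₂ : D.Feasible F₂) (he₁ : e ∉ F₁) (he₂ : e ∉ F₂) : Even ((F₁ ∆ F₂) ∩ X).ncard := by
  have h : ¬ D.IsColoop e := fun h => he₁ (h _ h₁)
  exact hX ((delete_feasible_iff h).2 ⟨h₁, he₁⟩) ((delete_feasible_iff h).2 ⟨h₂, he₂⟩)

theorem ParitySep.mem_iff_of_delete (hX : (D.delete e).ParitySep X) (h₁ : D.Feasible F)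
    (h₂ : D.Feasible (F ∆ {x, y})) (he : e ∉ F) (hx : e ≠ x) (hy : e ≠ y) : x ∈ X ↔ y ∈ X := by
  by_cases hxy : x = y
  · rw [hxy]
  · have := hX.even_of_delete h₁ h₂ he (by simp [Set.mem_symmDiff, he, hx, hy])
    rwa [symmDiff_symmDiff_cancel_left, even_ncard_pair_inter X hxy] at this

theorem ParitySep.mem_iff_of_contract (hX : (D.contract e).ParitySep X) (h₁ : D.Feasible F₁)
    (h₂ : D.Feasible F₂) (he₁ : e ∈ F₁) (he₂ : e ∈ F₂) (h : F₁ ∆ F₂ = {x, y}) :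
    x ∈ X ↔ y ∈ X := by
  by_cases hxy : x = y
  · rw [hxy]
  have hl : ¬ D.IsLoop e := fun h => h _ h₁ he₁
  have hf : ∀ F, D.Feasible F → e ∈ F → (D.contract e).Feasible (F \ {e}) := fun F hF he =>
    (contract_feasible_iff hl).2
      ⟨by rwa [insert_sdiff_singleton, insert_eq_of_mem he], fun h => h.2 rfl⟩
  have := hX (hf _ h₁ he₁) (hf _ h₂ he₂)
  rwa [← symmDiff_singleton_of_mem he₁, ← symmDiff_singleton_of_mem he₂, symmDiff_twist_twist, h,
    even_ncard_pair_inter X hxy] at this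

/-- If `D` is connected, then `e` has a neighbour in every non-empty separator of `D.delete e`. -/
theorem IsConnected.exists_feasible_pair (hc : D.IsConnected) (hD : D.IsEven) (heE : e ∈ D.E)
    (hA : (D.delete e).ParitySep A) (hAE : A ⊆ D.E \ {e}) (hne : A.Nonempty)
    (hF : D.Feasible F) (heF : e ∉ F) : ∃ a ∈ A, D.Feasible (F ∆ {e, a}) := by
  by_contra! hno
  have hcross : D.NoCrossing F A := by
    intro u v hu hv huv
    have hu' : e ≠ u := fun h => (hAE hu).2 h.symm
    by_cases hv' : e = v
    · subst hv'
      exact hno u hu (pair_comm u e ▸ huv)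
    · exact hv ((hA.mem_iff_of_delete hF huv heF hu' hv').1 hu)
  rcases hD.isConnected_iff.1 hc A (hAE.trans sdiff_subset) (hcross.paritySep hD hF) with h | h
  · exact hne.ne_empty h
  · exact (hAE (h ▸ heE)).2 rfl

/-- Let `a ∈ A` be a neighbour of `e`, where `A` separates `D.delete e`. A separator of
`D.contract e` that contains `a` contains all elements outside `A`, since the others among these
would form a separator of `D`. -/
theorem IsConnected.sdiff_subset_of_paritySep_contract (hc : D.IsConnected) (hD : D.IsEven)
    (heE : e ∈ D.E) (hA : (D.delete e).ParitySep A) (hAE : A ⊆ D.E \ {e}) (hF : D.Feasible F)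
    (heF : e ∉ F) (ha : a ∈ A) (hFa : D.Feasible (F ∆ {e, a}))
    (hY : (D.contract e).ParitySep Y) (haY : a ∈ Y) : (D.E \ {e}) \ A ⊆ Y := by
  have hea : e ≠ a := fun h => (hAE ha).2 h.symm
  have heFa : e ∈ F ∆ {e, a} := by simp [Set.mem_symmDiff, heF]
  -- `e` has no neighbour outside `A ∪ Y`
  have hadj : ∀ u, u ∉ A → u ∉ Y → ¬ D.Feasible (F ∆ {e, u}) := by
    intro u huA huY hu
    have hua : u ≠ a := fun h => huA (h ▸ ha)
    by_cases heu : e = u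
    · subst heu
      have := hD.even_symmDiff hF hu
      rw [symmDiff_symmDiff_cancel_left] at this
      simp at this
    refine huY ((hY.mem_iff_of_contract hFa hu heFa (by simp [Set.mem_symmDiff, heF]) ?_).1 haY)
    rw [symmDiff_symmDiff_symmDiff_comm, symmDiff_self, bot_symmDiff]
    exact pair_symmDiff_pair hea heu hua.symm
  have hcross : D.NoCrossing F (((D.E \ {e}) \ A) \ Y) := by
    rintro u v ⟨⟨⟨huE, hue⟩, huA⟩, huY⟩ hv huv
    have hue : e ≠ u := fun h => hue h.symm
    have hua : a ≠ u := fun h => huA (h ▸ ha)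
    by_cases hve : e = v
    · subst hve
      exact hadj u huA huY (pair_comm u e ▸ huv)
    have hvA : v ∉ A := fun h => huA ((hA.mem_iff_of_delete hF huv heF hue hve).2 h)
    have huv' : u ≠ v := by
      rintro rfl
      exact hv ⟨⟨⟨huE, fun h => hue h.symm⟩, huA⟩, huY⟩
    have hva : a ≠ v := fun h => hvA (h ▸ ha)
    have hvE : v ∈ D.E := by
      by_cases hvF : v ∈ F
      · exact D.subset_ground _ hF hvF
      · exact D.subset_ground _ huv (by simp [Set.mem_symmDiff, hvF])
    have hvY : v ∈ Y := by
      by_contra hvY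
      exact hv ⟨⟨⟨hvE, fun h => hve h.symm⟩, hvA⟩, hvY⟩
    have hdiff : (F ∆ {u, v}) ∆ (F ∆ {e, a}) = {u, v} ∪ {e, a} := by
      rw [symmDiff_symmDiff_symmDiff_comm, symmDiff_self, bot_symmDiff]
      refine Disjoint.symmDiff_eq_sup ?_
      rw [Set.disjoint_left]
      rintro z (rfl | rfl) (rfl | h) <;> simp_all
    -- as `a` has no neighbour outside `A` other than `e`, exchanging `a` must produce
    -- `F ∆ {u, v, e, a}`, which contains `e`
    obtain ⟨w, hw, haw, hfw⟩ := hD.exists_ne huv hFa (x := a) (by rw [hdiff]; simp)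
    rw [hdiff] at hw
    have hnadj : ∀ z, z ∉ A → e ≠ z → ¬ D.Feasible (F ∆ {z, a}) := fun z hz hez h =>
      hz ((hA.mem_iff_of_delete hF h heF hez hea).2 ha)
    simp only [mem_union, Set.mem_insert_iff, Set.mem_singleton_iff] at hw
    rcases hw with (rfl | rfl) | (rfl | rfl)
    · refine hnadj v hvA hve ?_
      convert hfw using 1
      rw [symmDiff_assoc]
      rw [pair_comm a w, pair_symmDiff_pair huv' hua.symm hva.symm]
    · refine hnadj u huA hue ?_
      convert hfw using 1
      rw [symmDiff_assoc]
      rw [pair_comm a w, pair_comm u w, pair_symmDiff_pair huv'.symm hva.symm hua.symm]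
    · refine huY ((hY.mem_iff_of_contract (x := u) (y := v) hFa hfw heFa ?_ ?_).2 hvY)
      · simp [Set.mem_symmDiff, heF, hue, hve]
      · rw [pair_comm a w, symmDiff_symmDiff_symmDiff_comm, symmDiff_symmDiff_cancel_left,
          symmDiff_self, symmDiff_bot]
    · exact haw rfl
  rw [← sdiff_eq_empty]
  rcases hD.isConnected_iff.1 hc _ (sdiff_subset.trans (sdiff_subset.trans sdiff_subset))
    (hcross.paritySep hD hF) with h | h
  · exact h
  · have heW : e ∈ ((D.E \ {e}) \ A) \ Y := by rwa [h]
    exact (heW.1.1.2 rfl).elim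

theorem IsEven.delete (hD : D.IsEven) (he : e ∈ D.E) : (D.delete e).IsEven :=
  (exists_isSliceOf_delete he).elim fun _ h => h.isEven hD

theorem IsEven.contract (hD : D.IsEven) (he : e ∈ D.E) : (D.contract e).IsEven :=
  (exists_isSliceOf_contract he).elim fun _ h => h.isEven hD

theorem ParitySep.sdiff (hD : D.IsEven) (hX : D.ParitySep X) : D.ParitySep (D.E \ X) :=
  (hX.compl hD).of_inter_ground (by
    ext z
    simp only [mem_inter_iff, mem_compl_iff, Set.mem_sdiff]
    tauto)

/-- If `D` is connected and `A` properly separates `D.delete e`, then `D.contract e` is connected: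
for neighbours `a ∈ A` and `b ∉ A` of `e`, a separator containing `a` contains the complement of
`A`, in particular `b`, and then it contains `A` as well. -/
theorem IsConnected.contract_of_paritySep_delete (hc : D.IsConnected) (hD : D.IsEven)
    (heE : e ∈ D.E) (hA : (D.delete e).ParitySep A) (hAE : A ⊆ D.E \ {e}) (hne : A.Nonempty)
    (hne' : ((D.E \ {e}) \ A).Nonempty) (hF : D.Feasible F) (heF : e ∉ F) :
    (D.contract e).IsConnected := by
  have hB : (D.delete e).ParitySep ((D.E \ {e}) \ A) := by
    have := hA.sdiff (hD.delete heE)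
    rwa [delete_ground] at this
  obtain ⟨a, ha, hFa⟩ := hc.exists_feasible_pair hD heE hA hAE hne hF heF
  obtain ⟨b, hb, hFb⟩ := hc.exists_feasible_pair hD heE hB sdiff_subset hne' hF heF
  have hall : ∀ Y, (D.contract e).ParitySep Y → a ∈ Y → D.E \ {e} ⊆ Y := by
    intro Y hY haY
    have h₁ := hc.sdiff_subset_of_paritySep_contract hD heE hA hAE hF heF ha hFa hY haY
    have h₂ := hc.sdiff_subset_of_paritySep_contract hD heE hB sdiff_subset hF heF hb hFb hY
      (h₁ hb)
    rw [sdiff_sdiff_cancel_left hAE] at h₂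
    intro z hz
    by_cases hzA : z ∈ A
    · exact h₂ hzA
    · exact h₁ ⟨hz, hzA⟩
  rw [(hD.contract heE).isConnected_iff, contract_ground]
  intro Y hYE hY
  by_cases haY : a ∈ Y
  · exact Or.inr (hYE.antisymm (hall Y hY haY))
  · have hY' := hY.sdiff (hD.contract heE)
    rw [contract_ground] at hY'
    refine Or.inl (eq_empty_of_forall_notMem fun z hz => ?_)
    exact (hall _ hY' ⟨hAE ha, haY⟩ (hYE hz)).2 hz

/-- A slice inside a separator `A` of `D.delete e` is also a minor of `D.contract e`: as `e` has
a neighbour `b` outside `A`, the set `Z` can be replaced by `Z ∆ {e, b}`. -/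
theorem IsSliceOf.exchange_of_paritySep_delete (h : D'.IsSliceOf D Z) (hD : D.IsEven)
    (heE : e ∈ D.E)
    (hA : (D.delete e).ParitySep A) (hD'A : D'.E ⊆ A) (he : e ∉ A) (heZ : e ∉ Z)
    (hbE : b ∈ D.E) (hbA : b ∉ A) (hbe : e ≠ b) (hF : D'.Feasible F)
    (hFb : D.Feasible ((F ∪ Z) ∆ {e, b})) : D'.IsSliceOf D (Z ∆ {e, b}) := by
  have heD' : e ∉ D'.E := fun h => he (hD'A h)
  have hbD' : b ∉ D'.E := fun h => hbA (hD'A h)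
  have hFZ := h.feasible_union hF
  have hFD' := D'.subset_ground F hF
  have hZD' : ∀ z, z ∈ Z → z ∉ D'.E := fun z hz => (h.subset_sdiff hz).2
  refine ⟨h.subset, symmDiff_subset_union.trans (union_subset h.subset_sdiff ?_), fun G hG => ?_⟩
  · rintro z (rfl | rfl)
    exacts [⟨heE, heD'⟩, ⟨hbE, hbD'⟩]
  have heq : G ∪ Z ∆ {e, b} = (G ∪ Z) ∆ {e, b} := by
    ext z
    have d₁ : z = e → z ∉ G := by rintro rfl h; exact heD' (hG h)
    have d₂ : z = b → z ∉ G := by rintro rfl h; exact hbD' (hG h)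
    simp only [Set.mem_symmDiff, Set.mem_insert_iff, Set.mem_singleton_iff, mem_union]
    tauto
  have hdiff : (G ∪ Z) ∆ (F ∪ Z) = G ∆ F := by
    ext z
    have d₁ := hZD' z
    have d₂ := @hG z
    have d₃ := @hFD' z
    simp only [Set.mem_symmDiff, mem_union]
    tauto
  have hGF : G ∆ F ⊆ D'.E := symmDiff_subset_union.trans (union_subset hG hFD')
  have heG : e ∉ G ∪ Z := fun h => h.elim (fun h => heD' (hG h)) heZ
  have heF : e ∉ F ∪ Z := fun h => h.elim (fun h => heD' (hFD' h)) heZ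
  have hdisj : Disjoint (G ∆ F) {e, b} := by
    rw [Set.disjoint_right]
    rintro z (rfl | rfl) hz
    exacts [heD' (hGF hz), hbD' (hGF hz)]
  rw [h.feasible_iff G hG, heq]
  constructor
  · intro hGZ
    have hdiff' : (G ∪ Z) ∆ ((F ∪ Z) ∆ {e, b}) = G ∆ F ∪ {e, b} := by
      rw [← symmDiff_assoc, hdiff]
      exact hdisj.symmDiff_eq_sup
    obtain ⟨y, hy, hby, hfy⟩ := hD.exists_ne hGZ hFb (x := b) (by rw [hdiff']; simp)
    rw [hdiff'] at hy
    rcases hy with hy | rfl | rfl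
    · have hyA := hD'A (hGF hy)
      exact (hbA ((hA.mem_iff_of_delete hGZ hfy heG hbe
        fun h => he (h ▸ hyA)).2 hyA)).elim
    · rwa [pair_comm]
    · exact (hby rfl).elim
  · intro hGb
    have hdiff' : ((G ∪ Z) ∆ {e, b}) ∆ (F ∪ Z) = G ∆ F ∪ {e, b} := by
      rw [symmDiff_right_comm, hdiff]
      exact hdisj.symmDiff_eq_sup
    obtain ⟨y, hy, hey, hfy⟩ := hD.exists_ne hGb hFZ (x := e) (by rw [hdiff']; simp)
    rw [hdiff'] at hy
    rcases hy with hy | rfl | rfl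
    · have hyD' := hGF hy
      have hyb : b ≠ y := fun h => hbD' (h ▸ hyD')
      have heq' : ((G ∪ Z) ∆ {e, b}) ∆ {e, y} = (G ∪ Z) ∆ {b, y} := by
        rw [symmDiff_assoc, pair_symmDiff_pair hbe hey hyb]
      rw [heq'] at hfy
      -- this feasible set avoids `e` and differs from `F ∪ Z` outside `A` in `b` only
      have hB := (hA.compl (hD.delete heE)).even_of_delete hfy hFZ
        (by simp [Set.mem_symmDiff, heG, hbe, hey, -mem_union]) heF
      have hone : ((G ∪ Z) ∆ {b, y}) ∆ (F ∪ Z) ∩ Aᶜ = {b} := by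
        rw [symmDiff_right_comm, hdiff, inter_symmDiff_distrib_right, insert_inter_of_mem hbA,
          singleton_inter_eq_empty.2 (by simpa using hD'A hyD'),
          (disjoint_compl_right_iff_subset.2 (hGF.trans hD'A)).inter_eq, ← bot_eq_empty,
          bot_symmDiff]
        simp
      rw [hone] at hB
      simp at hB
    · exact (hey rfl).elim
    · rwa [symmDiff_symmDiff_cancel_right] at hfy

/-! ### The splitter theorem for even delta-matroids -/

/-- The splitter theorem in the case where `D'` arises from `D` by deleting `e`. The other case
follows from it by a twist. -/
theorem IsConnected.splitter_of_notMem (hc : D.IsConnected) (hD : D.IsEven)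
    (hc' : D'.IsConnected) (h : D'.IsSliceOf D Z) (heE : e ∈ D.E) (heD' : e ∉ D'.E)
    (heZ : e ∉ Z) :
    ((D.delete e).IsConnected ∧ (D.delete e).HasMinor D') ∨
      ((D.contract e).IsConnected ∧ (D.contract e).HasMinor D') := by
  by_cases hdc : (D.delete e).IsConnected
  · exact Or.inl ⟨hdc, (h.delete heD' heZ).hasMinor⟩
  right
  have hev := hD.delete heE
  obtain ⟨A, hAE, hA, hne, hne', hD'A⟩ : ∃ A, A ⊆ D.E \ {e} ∧ (D.delete e).ParitySep A ∧
      A.Nonempty ∧ ((D.E \ {e}) \ A).Nonempty ∧ D'.E ⊆ A := by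
    rw [hev.isConnected_iff, delete_ground] at hdc
    push Not at hdc
    -- `D'` is connected, so it lies on one side of `X`
    obtain ⟨X, hXE, hX, hne, hne'⟩ := hdc
    have hne'' : ((D.E \ {e}) \ X).Nonempty := by
      rw [Set.sdiff_nonempty]
      exact fun hsub => hne' (hXE.antisymm hsub)
    have hX' := hX.sdiff hev
    rw [delete_ground] at hX'
    have hsub := (h.delete heD' heZ).subset
    rw [delete_ground] at hsub
    have hsep : D'.ParitySep (X ∩ D'.E) :=
      ((h.delete heD' heZ).paritySep hX).of_inter_ground (by rw [inter_assoc, inter_self])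
    rcases (h.isEven hD).isConnected_iff.1 hc' _ inter_subset_right hsep with h0 | h0
    · refine ⟨_, sdiff_subset, hX', hne'', by rwa [sdiff_sdiff_cancel_left hXE], ?_⟩
      exact fun z hz => ⟨hsub hz, fun hzX => (h0 ▸ (⟨hzX, hz⟩ : z ∈ X ∩ D'.E) : z ∈ (∅ : Set α))⟩
    · exact ⟨X, hXE, hX, hne, hne'', inter_eq_right.1 h0⟩
  obtain ⟨F, hF⟩ := D'.exists_feasible
  have hFZ := h.feasible_union hF
  have heFZ : e ∉ F ∪ Z := fun h => h.elim (fun h => heD' (D'.subset_ground F hF h)) heZ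
  refine ⟨hc.contract_of_paritySep_delete hD heE hA hAE hne hne' hFZ heFZ, ?_⟩
  have hB := hA.sdiff hev
  rw [delete_ground] at hB
  obtain ⟨b, ⟨⟨hbE, hbe⟩, hbA⟩, hFb⟩ :=
    hc.exists_feasible_pair hD heE hB sdiff_subset hne' hFZ heFZ
  have hslice := h.exchange_of_paritySep_delete hD heE hA hD'A (fun h => (hAE h).2 rfl) heZ hbE hbA
    (fun h => hbe h.symm) hF hFb
  exact (hslice.contract (e := e) (by simp [Set.mem_symmDiff, heZ])).hasMinor

theorem IsConnected.splitter (hc : D.IsConnected) (hD : D.IsEven) (hc' : D'.IsConnected)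
    (h : D.HasMinor D') (heE : e ∈ D.E) (heD' : e ∉ D'.E) :
    ((D.delete e).IsConnected ∧ (D.delete e).HasMinor D') ∨
      ((D.contract e).IsConnected ∧ (D.contract e).HasMinor D') := by
  obtain ⟨Z, hZ⟩ := h.exists_isSliceOf
  by_cases heZ : e ∈ Z
  · have := (hc.twist hD heE).splitter_of_notMem (hD.twist heE) hc' (hZ.twist heZ heE) heE heD'
      fun h => h.2 rfl
    rw [delete_twist, contract_twist] at this
    exact this.symm
  · exact hc.splitter_of_notMem hD hc' hZ heE heD' heZ

end DeltaMatroid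

namespace Matroid

variable {α : Type*} {M N : Matroid α} {e : α}

/-! ### Matroids as even delta-matroids -/

/-- The delta-matroid of a finite matroid: its feasible sets are the bases. -/
def toDeltaMatroid (M : Matroid α) (hM : M.E.Finite) : DeltaMatroid α where
  E := M.E
  Feasible := M.IsBase
  finite_ground := hM
  subset_ground := fun _ h => h.subset_ground
  exists_feasible := M.exists_isBase
  symm_exchange := by
    intro B₁ B₂ h₁ h₂ x hx
    rcases hx with hx | hx
    · obtain ⟨y, hy, hB⟩ := h₁.exchange h₂ hx
      refine ⟨y, Or.inr hy, ?_⟩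
      convert hB using 1
      ext z
      have := hx.1
      have := hy.2
      simp only [Set.mem_symmDiff, Set.mem_insert_iff, Set.mem_singleton_iff, Set.mem_sdiff]
      grind
    -- here the exchange takes place in the dual matroid
    · have h₁' : M.IsBase B₁ := h₁
      have h₂' : M.IsBase B₂ := h₂
      have h₁E := h₁'.subset_ground
      have h₂E := h₂'.subset_ground
      obtain ⟨y, hy, hB⟩ := h₁'.compl_isBase_dual.exchange h₂'.compl_isBase_dual (e := x)
        ⟨⟨h₂E hx.1, hx.2⟩, fun h => h.2 hx.1⟩
      have hy' : y ∈ B₁ \ B₂ := ⟨by_contra fun h => hy.2 ⟨hy.1.1, h⟩, hy.1.2⟩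
      refine ⟨y, Or.inl hy', ?_⟩
      convert hB.compl_isBase_of_dual using 1
      ext z
      have := @h₁E z
      have := @h₂E z
      have := hx.1
      have := hx.2
      have := hy'.1
      simp only [Set.mem_symmDiff, Set.mem_insert_iff, Set.mem_singleton_iff, Set.mem_sdiff]
      grind

theorem toDeltaMatroid_isEven (hM : M.E.Finite) : (M.toDeltaMatroid hM).IsEven :=
  fun _ _ h₁ h₂ => by rw [IsBase.ncard_eq_ncard_of_isBase h₁ h₂]

theorem toDeltaMatroid_congr (h : M = N) (hM : M.E.Finite) :
    M.toDeltaMatroid hM = N.toDeltaMatroid (h ▸ hM) := by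
  subst h; rfl

theorem toDeltaMatroid_injective {hM : M.E.Finite} {hN : N.E.Finite}
    (h : M.toDeltaMatroid hM = N.toDeltaMatroid hN) : M = N :=
  ext_isBase (congrArg DeltaMatroid.E h) fun B _ => by
    rw [show M.IsBase = N.IsBase from congrArg DeltaMatroid.Feasible h]

theorem isLoop_toDeltaMatroid_iff (hM : M.E.Finite) (he : e ∈ M.E) :
    (M.toDeltaMatroid hM).IsLoop e ↔ M.IsLoop e :=
  (isLoop_iff_forall_notMem_isBase he).symm

theorem isColoop_toDeltaMatroid_iff (hM : M.E.Finite) :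
    (M.toDeltaMatroid hM).IsColoop e ↔ M.IsColoop e :=
  isColoop_iff_forall_mem_isBase.symm

theorem toDeltaMatroid_delete_of_not_isColoop (hM : M.E.Finite) (he : e ∈ M.E)
    (h : ¬ M.IsColoop e) :
    (M ＼ {e}).toDeltaMatroid (hM.subset sdiff_subset) = (M.toDeltaMatroid hM).delete e := by
  refine DeltaMatroid.ext (DeltaMatroid.delete_ground (M.toDeltaMatroid hM) e).symm
    (funext fun B => propext ?_)
  rw [DeltaMatroid.delete_feasible_iff (by rwa [isColoop_toDeltaMatroid_iff])]
  have hco : M.Coindep {e} := by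
    rw [isColoop_iff_forall_mem_isBase] at h
    push Not at h
    obtain ⟨B', hB', heB'⟩ := h
    exact coindep_iff_subset_compl_isBase.2 ⟨B', hB', by simp [he, heB']⟩
  change (M ＼ {e}).IsBase B ↔ M.IsBase B ∧ e ∉ B
  rw [hco.delete_isBase_iff, disjoint_singleton_right]

theorem toDeltaMatroid_contract_of_not_isLoop (hM : M.E.Finite) (he : e ∈ M.E)
    (h : ¬ M.IsLoop e) :
    (M ／ {e}).toDeltaMatroid (hM.subset sdiff_subset) = (M.toDeltaMatroid hM).contract e := by
  refine DeltaMatroid.ext (DeltaMatroid.contract_ground (M.toDeltaMatroid hM) e).symm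
    (funext fun B => propext ?_)
  rw [DeltaMatroid.contract_feasible_iff (by rwa [isLoop_toDeltaMatroid_iff hM he])]
  change (M ／ {e}).IsBase B ↔ M.IsBase (insert e B) ∧ e ∉ B
  rw [((not_isLoop_iff he).1 h).indep.contract_isBase_iff, union_singleton,
    disjoint_singleton_right]

theorem toDeltaMatroid_delete (hM : M.E.Finite) (he : e ∈ M.E) :
    (M ＼ {e}).toDeltaMatroid (hM.subset sdiff_subset) = (M.toDeltaMatroid hM).delete e := by
  by_cases h : M.IsColoop e
  · rw [DeltaMatroid.delete_of_isColoop ((isColoop_toDeltaMatroid_iff hM).2 h),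
      ← toDeltaMatroid_contract_of_not_isLoop hM he fun h' => h'.not_isColoop h]
    exact toDeltaMatroid_congr
      (contract_eq_delete_of_subset_coloops (singleton_subset_iff.2 h)).symm _
  · exact toDeltaMatroid_delete_of_not_isColoop hM he h

theorem toDeltaMatroid_contract (hM : M.E.Finite) (he : e ∈ M.E) :
    (M ／ {e}).toDeltaMatroid (hM.subset sdiff_subset) = (M.toDeltaMatroid hM).contract e := by
  by_cases h : M.IsLoop e
  · rw [DeltaMatroid.contract_of_isLoop ((isLoop_toDeltaMatroid_iff hM he).2 h),
      ← toDeltaMatroid_delete hM he]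
    exact toDeltaMatroid_congr
      (contract_eq_delete_of_subset_loops (singleton_subset_iff.2 h)) _
  · exact toDeltaMatroid_contract_of_not_isLoop hM he h

theorem hasMinor_toDeltaMatroid_delete (hM : M.E.Finite) {S : Set α} (hS : S ⊆ M.E) :
    (M.toDeltaMatroid hM).HasMinor ((M ＼ S).toDeltaMatroid (hM.subset sdiff_subset)) := by
  induction S, hM.subset hS using Set.Finite.induction_on with
  | empty =>
    rw [toDeltaMatroid_congr (delete_empty M)]
    exact DeltaMatroid.HasMinor.refl
  | @insert e S heS _ ih =>
    have heE : e ∈ (M ＼ S).E := ⟨hS (mem_insert e S), heS⟩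
    have h : M ＼ insert e S = M ＼ S ＼ {e} := by rw [delete_delete, union_singleton]
    rw [toDeltaMatroid_congr h, toDeltaMatroid_delete (hM.subset sdiff_subset) heE]
    exact (ih ((subset_insert e S).trans hS)).delete e heE

theorem hasMinor_toDeltaMatroid_contract (hM : M.E.Finite) {S : Set α} (hS : S ⊆ M.E) :
    (M.toDeltaMatroid hM).HasMinor ((M ／ S).toDeltaMatroid (hM.subset sdiff_subset)) := by
  induction S, hM.subset hS using Set.Finite.induction_on with
  | empty =>
    rw [toDeltaMatroid_congr (contract_empty M)]
    exact DeltaMatroid.HasMinor.refl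
  | @insert e S heS _ ih =>
    have heE : e ∈ (M ／ S).E := ⟨hS (mem_insert e S), heS⟩
    have h : M ／ insert e S = M ／ S ／ {e} := by rw [contract_contract, union_singleton]
    rw [toDeltaMatroid_congr h, toDeltaMatroid_contract (hM.subset sdiff_subset) heE]
    exact (ih ((subset_insert e S).trans hS)).contract e heE

theorem IsMinor.hasMinor_toDeltaMatroid (h : N ≤m M) (hM : M.E.Finite) :
    (M.toDeltaMatroid hM).HasMinor (N.toDeltaMatroid (hM.subset h.subset)) := by
  obtain ⟨C, S, hN⟩ := h
  have hN' : N = M ／ (C ∩ M.E) ＼ (S ∩ (M ／ (C ∩ M.E)).E) := by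
    rw [delete_inter_ground_eq, contract_inter_ground_eq, hN]
  rw [toDeltaMatroid_congr hN']
  exact (hasMinor_toDeltaMatroid_contract hM inter_subset_right).trans
    (hasMinor_toDeltaMatroid_delete (hM.subset sdiff_subset) inter_subset_right)

theorem exists_isMinor_of_hasMinor {hM : M.E.Finite} {D : DeltaMatroid α}
    (h : (M.toDeltaMatroid hM).HasMinor D) :
    ∃ (N : Matroid α) (hN : N.E.Finite), D = N.toDeltaMatroid hN ∧ N ≤m M := by
  induction h with
  | refl => exact ⟨M, hM, rfl, IsMinor.refl⟩
  | delete e he _ ih =>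
    obtain ⟨N, hN, rfl, hNM⟩ := ih
    exact ⟨_, _, (toDeltaMatroid_delete hN he).symm,
      IsMinor.trans ⟨∅, {e}, by rw [contract_empty]⟩ hNM⟩
  | contract e he _ ih =>
    obtain ⟨N, hN, rfl, hNM⟩ := ih
    exact ⟨_, _, (toDeltaMatroid_contract hN he).symm,
      IsMinor.trans ⟨{e}, ∅, by rw [delete_empty]⟩ hNM⟩

theorem hasMinor_toDeltaMatroid_iff {hM : M.E.Finite} {hN : N.E.Finite} :
    (M.toDeltaMatroid hM).HasMinor (N.toDeltaMatroid hN) ↔ N ≤m M := by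
  refine ⟨fun h => ?_, fun h => h.hasMinor_toDeltaMatroid hM⟩
  obtain ⟨N', hN', heq, hNM⟩ := exists_isMinor_of_hasMinor h
  rwa [toDeltaMatroid_injective heq]

theorem disjointSum_toDeltaMatroid {M₁ M₂ : Matroid α} (h : Disjoint M₁.E M₂.E)
    (h₁ : M₁.E.Finite) (h₂ : M₂.E.Finite) (hM : (M₁.disjointSum M₂ h).E.Finite) :
    (M₁.disjointSum M₂ h).toDeltaMatroid hM =
      (M₁.toDeltaMatroid h₁).directSum (M₂.toDeltaMatroid h₂) h := by
  refine DeltaMatroid.ext disjointSum_ground_eq (funext fun B => propext ⟨fun hB => ?_, ?_⟩)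
  · obtain ⟨B₁, B₂, hB₁, hB₂, -, rfl⟩ := IsBase.eq_union_image_of_disjointSum (h := h) hB
    exact ⟨B₁, B₂, hB₁, hB₂, rfl⟩
  · rintro ⟨B₁, B₂, hB₁, hB₂, rfl⟩
    have s₁ : B₁ ⊆ M₁.E := IsBase.subset_ground hB₁
    have s₂ : B₂ ⊆ M₂.E := IsBase.subset_ground hB₂
    refine disjointSum_isBase_iff.2 ⟨?_, ?_, union_subset_union s₁ s₂⟩
    · rwa [union_inter_distrib_right, inter_eq_left.2 s₁, (h.symm.mono_left s₂).inter_eq,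
        union_empty]
    · rwa [union_inter_distrib_right, inter_eq_left.2 s₂, (h.mono_left s₁).inter_eq,
        empty_union]

/-- If the delta-matroid of `M` is the direct sum of `D₁` and `D₂`, then the bases of the
restriction of `M` to the ground set of `D₁` are the feasible sets of `D₁`. -/
theorem isBasis_iff_of_isBase_iff_union {D₁ D₂ : DeltaMatroid α}
    (h : Disjoint D₁.E D₂.E) (hfeas : ∀ F, M.IsBase F ↔
      ∃ F₁ F₂, D₁.Feasible F₁ ∧ D₂.Feasible F₂ ∧ F = F₁ ∪ F₂)
    (hE : D₁.E ⊆ M.E) {I : Set α} : M.IsBasis I D₁.E ↔ D₁.Feasible I := by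
  have hinter : ∀ F₁ F₂, D₁.Feasible F₁ → D₂.Feasible F₂ → (F₁ ∪ F₂) ∩ D₁.E = F₁ := by
    intro F₁ F₂ h₁ h₂
    rw [union_inter_distrib_right, inter_eq_left.2 (D₁.subset_ground _ h₁),
      (h.symm.mono_left (D₂.subset_ground _ h₂)).inter_eq, union_empty]
  have hindep : ∀ F₁, D₁.Feasible F₁ → M.Indep F₁ := by
    intro F₁ h₁
    obtain ⟨F₂, h₂⟩ := D₂.exists_feasible
    exact ((hfeas _).2 ⟨F₁, F₂, h₁, h₂, rfl⟩).indep.subset subset_union_left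
  have hext : ∀ J, M.Indep J → J ⊆ D₁.E → ∃ F₁, D₁.Feasible F₁ ∧ J ⊆ F₁ := by
    intro J hJ hJE
    obtain ⟨B, hB, hJB⟩ := hJ.exists_isBase_superset
    obtain ⟨F₁, F₂, h₁, h₂, rfl⟩ := (hfeas B).1 hB
    exact ⟨F₁, h₁, hinter F₁ F₂ h₁ h₂ ▸ subset_inter hJB hJE⟩
  constructor
  · intro hI
    obtain ⟨F₁, h₁, hIF⟩ := hext I hI.indep hI.subset
    rwa [hI.eq_of_subset_indep (hindep F₁ h₁) hIF (D₁.subset_ground _ h₁)]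
  · intro hI
    refine (hindep I hI).isBasis_of_maximal_subset (D₁.subset_ground _ hI)
      (fun J hJ hIJ hJE => ?_) hE
    obtain ⟨F₁, h₁, hJF⟩ := hext J hJ hJE
    obtain ⟨F₂, h₂⟩ := D₂.exists_feasible
    have heq : I ∪ F₂ = F₁ ∪ F₂ :=
      ((hfeas _).2 ⟨I, F₂, hI, h₂, rfl⟩).eq_of_subset_isBase ((hfeas _).2 ⟨F₁, F₂, h₁, h₂, rfl⟩)
        (union_subset_union_left _ (hIJ.trans hJF))
    rwa [← hinter I F₂ hI h₂, heq, hinter F₁ F₂ h₁ h₂]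

theorem matroidConnected_iff (hM : M.E.Finite) :
    MatroidConnected M ↔ (M.toDeltaMatroid hM).IsConnected := by
  refine not_congr ⟨?_, ?_⟩
  · rintro ⟨M₁, M₂, h, h₁, h₂, rfl⟩
    have hM' := hM
    rw [disjointSum_ground_eq, finite_union] at hM'
    refine ⟨M₁.E, ⟨_, _, h, disjointSum_toDeltaMatroid h hM'.1 hM'.2 hM, Or.inl rfl⟩,
      h₁.ne_empty, fun heq => ?_⟩
    obtain ⟨x, hx⟩ := h₂
    have hx' : x ∈ M₁.E := by
      rw [heq]
      change x ∈ (M₁.disjointSum M₂ h).E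
      exact disjointSum_ground_eq ▸ Or.inr hx
    exact Set.disjoint_left.1 h hx' hx
  · rintro ⟨X, ⟨D₁, D₂, h, heq, hX⟩, hne, hne'⟩
    have hE : M.E = D₁.E ∪ D₂.E := congrArg DeltaMatroid.E heq
    have hfeas : ∀ F, M.IsBase F ↔ ∃ F₁ F₂, D₁.Feasible F₁ ∧ D₂.Feasible F₂ ∧ F = F₁ ∪ F₂ :=
      fun F => iff_of_eq (congrFun (congrArg DeltaMatroid.Feasible heq) F)
    have hfeas' : ∀ F, M.IsBase F ↔ ∃ F₂ F₁, D₂.Feasible F₂ ∧ D₁.Feasible F₁ ∧ F = F₂ ∪ F₁ := by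
      intro F
      rw [hfeas]
      constructor <;> rintro ⟨F₁, F₂, h₁, h₂, rfl⟩ <;> exact ⟨F₂, F₁, h₂, h₁, union_comm _ _⟩
    have hne₁ : D₁.E.Nonempty ∧ D₂.E.Nonempty := by
      change X ≠ M.E at hne'
      rw [hE] at hne'
      simp only [nonempty_iff_ne_empty]
      rcases hX with rfl | rfl
      · exact ⟨hne, fun h0 => hne' (by rw [h0, union_empty])⟩
      · exact ⟨fun h0 => hne' (by rw [h0, empty_union]), hne⟩
    have hE₁ : D₁.E ⊆ M.E := hE ▸ subset_union_left
    have hE₂ : D₂.E ⊆ M.E := hE ▸ subset_union_right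
    have h' : Disjoint (M ↾ D₁.E).E (M ↾ D₂.E).E := h
    refine ⟨M ↾ D₁.E, M ↾ D₂.E, h', hne₁.1, hne₁.2, ?_⟩
    refine ext_isBase (by rw [disjointSum_ground_eq]; exact hE) fun B hB => ?_
    rw [disjointSum_isBase_iff, restrict_ground_eq, restrict_ground_eq, isBase_restrict_iff hE₁,
      isBase_restrict_iff hE₂, isBasis_iff_of_isBase_iff_union h hfeas hE₁,
      isBasis_iff_of_isBase_iff_union h.symm hfeas' hE₂, hfeas]
    constructor
    · rintro ⟨F₁, F₂, h₁, h₂, rfl⟩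
      have s₁ := D₁.subset_ground _ h₁
      have s₂ := D₂.subset_ground _ h₂
      refine ⟨?_, ?_, union_subset_union s₁ s₂⟩
      · rwa [union_inter_distrib_right, inter_eq_left.2 s₁, (h.symm.mono_left s₂).inter_eq,
          union_empty]
      · rwa [union_inter_distrib_right, inter_eq_left.2 s₂, (h.mono_left s₁).inter_eq,
          empty_union]
    · rintro ⟨h₁, h₂, hs⟩
      exact ⟨_, _, h₁, h₂, by rw [← inter_union_distrib_left, inter_eq_left.2 hs]⟩

end Matroid

theorem corollary3p3 {α : Type*} :
    (∀ D D' : DeltaMatroid α, D.IsEven → D.IsConnected → D'.IsConnected → D.HasMinor D' →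
      ∀ e ∈ D.E \ D'.E,
        ((D.delete e).IsConnected ∧ (D.delete e).HasMinor D') ∨
        ((D.contract e).IsConnected ∧ (D.contract e).HasMinor D')) ∧
    (∀ M N : Matroid α, M.Finite → MatroidConnected M → MatroidConnected N → N ≤m M →
      ∀ e ∈ M.E \ N.E,
        (MatroidConnected (M ＼ {e}) ∧ N ≤m (M ＼ {e})) ∨
        (MatroidConnected (M ／ {e}) ∧ N ≤m (M ／ {e}))) := by
  refine ⟨fun D D' hD hc hc' h e he => hc.splitter hD hc' h he.1 he.2, ?_⟩
  intro M N hfin hc hc' h e he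
  have hM : M.E.Finite := hfin.ground_finite
  have hN : N.E.Finite := hM.subset h.subset
  rw [Matroid.matroidConnected_iff hM] at hc
  rw [Matroid.matroidConnected_iff hN] at hc'
  have := hc.splitter (Matroid.toDeltaMatroid_isEven hM) hc'
    (Matroid.hasMinor_toDeltaMatroid_iff.2 h) (e := e) he.1 he.2
  rwa [← Matroid.toDeltaMatroid_delete hM he.1, ← Matroid.toDeltaMatroid_contract hM he.1,
    ← Matroid.matroidConnected_iff, ← Matroid.matroidConnected_iff,
    Matroid.hasMinor_toDeltaMatroid_iff, Matroid.hasMinor_toDeltaMatroid_iff] at this
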